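/- Let $\Gamma$ be a finitely generated group acting transitively on an infinite set $\Omega$. Let $\mathrm{FSym}(\Omega)$ be the group of finitely supported permutations of $\Omega$, and let $\mathcal{S}(\Gamma,\Omega)=\mathrm{FSym}(\Omega)\rtimes\Gamma$ be the symmetric enrichment of the action, where $\Gamma$ acts on $\mathrm{FSym}(\Omega)$ by conjugation through $\Gamma\to\mathrm{Sym}(\Omega)$. For a group $G$ generated by a finite set $S$, let $B_S(n)$ be the set of products of at most $n$ elements of $S\cup S^{-1}$, let $\gamma_G^S(n)=|B_S(n)|$ be the word growth, and let the LEF growth $\mathcal{L}_G^S(n)\in\mathbb{N}\cup\{\infty\}$ be the least order of a finite group $Q$ for which there is an injective map $\pi:B_S(n)\to Q$ such that $\pi(gh)=\pi(g)\pi(h)$ whenever $g,h,gh\in B_S(n)$ (and $\infty$ if there is no such $Q$). For $f_1,f_2:\mathbb{N}\to(0,\infty]$ write $f_1\preceq f_2$ if there is a constant $C>0$ such that $f_1(\lceil x\rceil)\le f_2(\lceil Cx\rceil)$ for all real $x>0$, and $f_1\approx f_2$ if $f_1\preceq f_2$ and $f_2\preceq f_1$. A finitely generated group $G$ is ELEF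 (efficiently locally embeddable in finite groups) if $\gamma_G^S\approx\mathcal{L}_G^S$ for some finite generating set $S$ (equivalently, for every one). Then $\mathcal{S}(\Gamma,\Omega)$ is finitely generated; for every finite generating set $T$ of $\mathcal{S}(\Gamma,\Omega)$ we have $$n!\preceq\mathcal{L}_{\mathcal{S}(\Gamma,\Omega)}^{T}(n);$$ and $\mathcal{S}(\Gamma,\Omega)$ is not ELEF. -/

import Mathlib

open scoped Nat

/-- The group `FSym(Ω)` of finitely supported permutations of `Ω`. -/
def FSym (Ω : Type*) : Subgroup (Equiv.Perm Ω) where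
  carrier := {σ | {x | σ x ≠ x}.Finite}
  one_mem' := by simp
  mul_mem' := by
    intro σ τ hσ hτ
    refine (Set.Finite.union hσ hτ).subset ?_
    intro x hx
    by_contra h
    simp only [Set.mem_union, Set.mem_ofPred_eq, not_or, not_not] at h
    exact hx (by rw [Equiv.Perm.mul_apply, h.2, h.1])
  inv_mem' := by
    intro σ hσ
    refine Set.Finite.subset hσ ?_
    intro x hx h
    exact hx (by rw [Equiv.Perm.inv_eq_iff_eq, h])

instance FSym.instNormal (Ω : Type*) : (FSym Ω).Normal where
  conj_mem := by
    intro σ hσ g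
    refine (Set.Finite.image g (show {x | σ x ≠ x}.Finite from hσ)).subset ?_
    intro x hx
    refine ⟨g⁻¹ x, ?_, by simp⟩
    intro h
    exact hx (by rw [Equiv.Perm.mul_apply, Equiv.Perm.mul_apply, h]; simp)

/-- The homomorphism `Γ → Aut(FSym(Ω))` induced by an action of `Γ` on `Ω`: the element `g` acts
by conjugation with the permutation `x ↦ g • x`. -/
def enrichmentAction (Γ Ω : Type*) [Group Γ] [MulAction Γ Ω] : Γ →* MulAut (FSym Ω) :=
  (MulAut.conjNormal (H := FSym Ω)).comp (MulAction.toPermHom Γ Ω)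

/-- The symmetric enrichment `FSym(Ω) ⋊ Γ` of an action of `Γ` on `Ω`. -/
abbrev SymmetricEnrichment (Γ Ω : Type*) [Group Γ] [MulAction Γ Ω] : Type _ :=
  SemidirectProduct (FSym Ω) Γ (enrichmentAction Γ Ω)

/-- The closed ball of radius `n` around `1` in the word metric on `G` with respect to `S`: the
elements which are products of at most `n` factors from `S ∪ S⁻¹`. -/
def wordBall {G : Type*} [Group G] (S : Set G) (n : ℕ) : Set G :=
  {g | ∃ l : List G, l.length ≤ n ∧ (∀ x ∈ l, x ∈ S ∨ x⁻¹ ∈ S) ∧ l.prod = g}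

/-- `π` restricts to a local embedding of the subset `F` of `G` into `Q`: it is injective on `F`
and multiplicative on those products of elements of `F` which lie in `F`. The values of `π`
outside `F` play no role. -/
def IsLocalEmbedding {G Q : Type*} [Group G] [Group Q] (F : Set G) (π : G → Q) : Prop :=
  Set.InjOn π F ∧ ∀ g ∈ F, ∀ h ∈ F, g * h ∈ F → π (g * h) = π g * π h

/-- The word growth function of `G` with respect to `S`. -/
noncomputable def wordGrowth {G : Type*} [Group G] (S : Set G) (n : ℕ) : ℕ∞ :=
  (wordBall S n).encard

/-- The LEF growth function of `G` with respect to `S`: the least order of a finite group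
admitting a local embedding of the ball of radius `n`, and `⊤` if there is no such group.
(Every finite group is isomorphic to one in `Type`.) -/
noncomputable def lefGrowth {G : Type*} [Group G] (S : Set G) (n : ℕ) : ℕ∞ :=
  sInf {k : ℕ∞ | ∃ (Q : Type) (_ : Group Q) (π : G → Q),
    Finite Q ∧ IsLocalEmbedding (wordBall S n) π ∧ k = (Nat.card Q : ℕ∞)}

/-- The comparison `f ⪯ g` of growth functions: `f(x) ≤ g(C x)` for all real `x > 0` and some
constant `C > 0`, where a function on `ℕ` is extended to `(0, ∞)` so as to be constant on each
interval `(n, n + 1]`, that is, by `x ↦ f ⌈x⌉`. -/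
def GrowthLE (f g : ℕ → ℕ∞) : Prop :=
  ∃ C : ℝ, 0 < C ∧ ∀ x : ℝ, 0 < x → f ⌈x⌉₊ ≤ g ⌈C * x⌉₊

/-- Equivalence `f ≈ g` of growth functions. -/
def GrowthEquiv (f g : ℕ → ℕ∞) : Prop :=
  GrowthLE f g ∧ GrowthLE g f

/-- `G` is efficiently locally embeddable in finite groups: `G` is finitely generated, and its word
growth and its LEF growth are equivalent with respect to some finite generating set (up to
equivalence, neither function depends on the generating set). -/
def IsELEF (G : Type*) [Group G] : Prop :=
  ∃ S : Set G, S.Finite ∧ Subgroup.closure S = ⊤ ∧ GrowthEquiv (wordGrowth S) (lefGrowth S)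

/-! ### Word balls, exponential growth bound, and size of orbits. -/

section WordBall

open scoped Pointwise

variable {G : Type*} [Group G] {S : Set G}

/-! Word growth is at most exponential and so cannot dominate `n!`; everything rests on the
factorial lower bound. Fix `x ∈ Ω`. The ball of radius `n` moves `x` to at least `n + 1` points, and
all transpositions of these points have word length `O(n)` (`IsSwapFamily.exists_mem_wordBall`). Let
`F` be `n + 1` of these points. A ball three times larger sees how the transpositions of `F`
conjugate one another. If it embeds locally in a finite group `Q`, then each `σ ∈ Sym(F)` is
realised by an element of `Q` permuting the images of the transpositions as `σ` does. When `|F| ≥ 3`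
this determines `σ`, so `|Q| ≥ |F|!` (`IsSwapFamily.factorial_le_card`). -/

theorem wordBall_mono (S : Set G) {m n : ℕ} (h : m ≤ n) : wordBall S m ⊆ wordBall S n := by
  rintro g ⟨l, hl, hS, rfl⟩
  exact ⟨l, hl.trans h, hS, rfl⟩

theorem one_mem_wordBall (S : Set G) (n : ℕ) : (1 : G) ∈ wordBall S n :=
  ⟨[], by simp, by simp, by simp⟩

theorem mem_wordBall_one {g : G} (hg : g ∈ S ∨ g⁻¹ ∈ S) : g ∈ wordBall S 1 :=
  ⟨[g], by simp, by simpa using hg, by simp⟩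

theorem mul_mem_wordBall {m n : ℕ} {g h : G} (hg : g ∈ wordBall S m) (hh : h ∈ wordBall S n) :
    g * h ∈ wordBall S (m + n) := by
  obtain ⟨l, hl, hS, rfl⟩ := hg
  obtain ⟨l', hl', hS', rfl⟩ := hh
  refine ⟨l ++ l', by simp; omega, ?_, by simp⟩
  intro x hx
  rcases List.mem_append.1 hx with hx | hx
  exacts [hS x hx, hS' x hx]

theorem inv_mem_wordBall {n : ℕ} {g : G} (hg : g ∈ wordBall S n) : g⁻¹ ∈ wordBall S n := by
  obtain ⟨l, hl, hS, rfl⟩ := hg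
  refine ⟨(l.map fun x => x⁻¹).reverse, by simpa using hl, ?_, by rw [List.prod_inv_reverse]⟩
  intro x hx
  simp only [List.mem_reverse, List.mem_map] at hx
  obtain ⟨y, hy, rfl⟩ := hx
  simpa using (hS y hy).symm

theorem conj_mem_wordBall {m n : ℕ} {g h : G} (hg : g ∈ wordBall S m) (hh : h ∈ wordBall S n) :
    g * h * g⁻¹ ∈ wordBall S (2 * m + n) := by
  convert mul_mem_wordBall (mul_mem_wordBall hg hh) (inv_mem_wordBall hg) using 1
  congr 1
  omega

/-- Induction on word length, peeling generators off from the left. -/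
theorem wordBall_induction {P : ℕ → G → Prop} (zero : P 0 1)
    (mono : ∀ n g, P n g → P (n + 1) g)
    (mul : ∀ n s g, (s ∈ S ∨ s⁻¹ ∈ S) → P n g → P (n + 1) (s * g)) :
    ∀ n, ∀ g ∈ wordBall S n, P n g := by
  rintro n g ⟨l, hl, hS, rfl⟩
  have key : P l.length l.prod := by
    clear hl
    induction l with
    | nil => simpa using zero
    | cons a l ih =>
      rw [List.prod_cons, List.length_cons]
      exact mul _ _ _ (hS a (by simp)) (ih fun x hx => hS x (by simp [hx]))
  induction hl with
  | refl => exact key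
  | step _ ih => exact mono _ _ ih

theorem exists_mem_wordBall (hS : Subgroup.closure S = ⊤) (g : G) : ∃ n, g ∈ wordBall S n := by
  induction (hS ▸ Subgroup.mem_top g : g ∈ Subgroup.closure S) using
    Subgroup.closure_induction with
  | mem s hs => exact ⟨1, mem_wordBall_one (Or.inl hs)⟩
  | one => exact ⟨0, one_mem_wordBall S 0⟩
  | mul g h _ _ hg hh =>
    obtain ⟨m, hm⟩ := hg
    obtain ⟨n, hn⟩ := hh
    exact ⟨m + n, mul_mem_wordBall hm hn⟩
  | inv g _ hg =>
    obtain ⟨n, hn⟩ := hg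
    exact ⟨n, inv_mem_wordBall hn⟩

theorem exists_subset_wordBall (hS : Subgroup.closure S = ⊤) {A : Set G} (hA : A.Finite) :
    ∃ n, A ⊆ wordBall S n := by
  induction A, hA using Set.Finite.induction_on with
  | empty => exact ⟨0, Set.empty_subset _⟩
  | @insert a A _ _ ih =>
    obtain ⟨n, hn⟩ := ih
    obtain ⟨m, hm⟩ := exists_mem_wordBall hS a
    exact ⟨max m n, Set.insert_subset (wordBall_mono S (le_max_left _ _) hm)
      (hn.trans (wordBall_mono S (le_max_right _ _)))⟩

/-- The word growth with respect to a finite set is at most exponential. -/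
theorem exists_wordGrowth_le_pow (hS : S.Finite) :
    ∃ M : ℕ, 0 < M ∧ ∀ n, wordGrowth S n ≤ ((M ^ n : ℕ) : ℕ∞) := by
  classical
  have hA : (insert 1 (S ∪ {x | x⁻¹ ∈ S})).Finite := by
    refine (hS.union ?_).insert 1
    exact hS.preimage inv_injective.injOn
  refine ⟨hA.toFinset.card, Finset.card_pos.2 ⟨1, by simp⟩, fun n => ?_⟩
  have hsub : wordBall S n ⊆ ((hA.toFinset ^ n : Finset G) : Set G) := by
    refine wordBall_induction (P := fun n g => g ∈ ((hA.toFinset ^ n : Finset G) : Set G))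
      (by simp) ?_ ?_ n
    · intro n g hg
      simp only [SetLike.mem_coe] at hg ⊢
      rw [pow_succ', ← one_mul g]
      exact Finset.mul_mem_mul (by simp) hg
    · intro n s g hs hg
      simp only [SetLike.mem_coe] at hg ⊢
      rw [pow_succ']
      exact Finset.mul_mem_mul (by simp [hs]) hg
  calc wordGrowth S n ≤ ((hA.toFinset ^ n : Finset G) : Set G).encard := Set.encard_le_encard hsub
    _ = ((hA.toFinset ^ n).card : ℕ∞) := Set.encard_coe_eq_coe_finsetCard _
    _ ≤ _ := by exact_mod_cast Finset.card_pow_le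

/-- If a group acts transitively on an infinite set, then the orbit of a point under the ball of
radius `n` has at least `n + 1` elements. -/
theorem exists_finset_subset_wordBall_orbit {Ω : Type*} [MulAction G Ω]
    [MulAction.IsPretransitive G Ω] [Infinite Ω] (hS : Subgroup.closure S = ⊤) (x : Ω) (n : ℕ) :
    ∃ F : Finset Ω, F.card = n + 1 ∧ ∀ y ∈ F, ∃ g ∈ wordBall S n, g • x = y := by
  classical
  induction n with
  | zero => exact ⟨{x}, by simp, by simpa using ⟨1, one_mem_wordBall S 0, one_smul _ _⟩⟩
  | succ n ih =>
    obtain ⟨F, hF, hFx⟩ := ih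
    -- Otherwise `F` is stable under the generators, as each of its points is `k • x` with `k` of
    -- length at most `n`; then the finite set `F` contains the whole orbit `Ω`.
    have hex : ∃ g ∈ wordBall S (n + 1), g • x ∉ F := by
      by_contra! hcon
      have hall : ∀ m, ∀ g ∈ wordBall S m, g • x ∈ F := by
        refine wordBall_induction ?_ (fun _ _ h => h) ?_
        · exact hcon 1 (one_mem_wordBall S _)
        · intro _ s g hs hg
          obtain ⟨k, hk, hkx⟩ := hFx _ hg
          rw [mul_smul, ← hkx, ← mul_smul]
          refine hcon _ ?_
          rw [add_comm]
          exact mul_mem_wordBall (mem_wordBall_one hs) hk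
      obtain ⟨y, hy⟩ := Infinite.exists_notMem_finset F
      obtain ⟨g, rfl⟩ := MulAction.exists_smul_eq G x y
      obtain ⟨m, hm⟩ := exists_mem_wordBall hS g
      exact hy (hall m g hm)
    obtain ⟨g, hg, hgF⟩ := hex
    refine ⟨insert (g • x) F, by rw [Finset.card_insert_of_notMem hgF, hF], ?_⟩
    intro y hy
    rcases Finset.mem_insert.1 hy with rfl | hy
    · exact ⟨g, hg, rfl⟩
    · obtain ⟨k, hk, rfl⟩ := hFx y hy
      exact ⟨k, wordBall_mono S (Nat.le_succ n) hk, rfl⟩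

end WordBall

/-! ### Comparison of growth functions. -/

section Growth

theorem GrowthLE.trans {f g h : ℕ → ℕ∞} (hfg : GrowthLE f g) (hgh : GrowthLE g h) :
    GrowthLE f h := by
  obtain ⟨C, hC, hfg⟩ := hfg
  obtain ⟨D, hD, hgh⟩ := hgh
  refine ⟨D * C, by positivity, fun x hx => (hfg x hx).trans ?_⟩
  rw [mul_assoc]
  exact hgh _ (by positivity)

/-- The factorial does not grow at most exponentially. -/
theorem not_growthLE_factorial {f : ℕ → ℕ∞} {M : ℕ} (hM : 0 < M)
    (hf : ∀ n, f n ≤ ((M ^ n : ℕ) : ℕ∞)) : ¬ GrowthLE (fun n : ℕ => (n ! : ℕ∞)) f := by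
  rintro ⟨C, hC, h⟩
  have hlim := FloorSemiring.tendsto_pow_div_factorial_atTop ((M : ℝ) ^ ⌈C⌉₊)
  obtain ⟨n, hn, hpos⟩ := ((hlim.eventually (gt_mem_nhds one_pos)).and
    (Filter.eventually_gt_atTop 0)).exists
  rw [div_lt_one (by positivity)] at hn
  have hle := (h n (by exact_mod_cast hpos)).trans (hf _)
  simp only [Nat.ceil_natCast, Nat.cast_le] at hle
  have hceil : ⌈C * n⌉₊ ≤ ⌈C⌉₊ * n := by
    refine Nat.ceil_le.2 ?_
    push_cast
    gcongr
    exact Nat.le_ceil C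
  have hle' : n ! ≤ (M ^ ⌈C⌉₊) ^ n := by
    rw [← pow_mul]
    exact hle.trans (Nat.pow_le_pow_right hM hceil)
  exact absurd hn (not_lt.2 (by exact_mod_cast hle'))

theorem lefGrowth_mono {G : Type*} [Group G] (S : Set G) : Monotone (lefGrowth S) := by
  intro m n h
  refine sInf_le_sInf ?_
  rintro k ⟨Q, _, π, hQ, ⟨hinj, hmul⟩, rfl⟩
  have hmn := wordBall_mono S h
  exact ⟨Q, _, π, hQ, ⟨hinj.mono hmn,
    fun g hg k hk hgk => hmul g (hmn hg) k (hmn hk) (hmn hgk)⟩, rfl⟩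

theorem le_lefGrowth_iff {G : Type*} [Group G] {S : Set G} {n : ℕ} {k : ℕ∞} :
    k ≤ lefGrowth S n ↔ ∀ (Q : Type) [Group Q] [Finite Q] (π : G → Q),
      IsLocalEmbedding (wordBall S n) π → k ≤ (Nat.card Q : ℕ∞) := by
  rw [lefGrowth, le_sInf_iff]
  constructor
  · intro h Q _ hQ π hπ
    exact h _ ⟨Q, _, π, hQ, hπ, rfl⟩
  · rintro h _ ⟨Q, _, π, hQ, hπ, rfl⟩
    exact h Q π hπ

theorem one_le_lefGrowth {G : Type*} [Group G] (S : Set G) (n : ℕ) : 1 ≤ lefGrowth S n := by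
  rw [le_lefGrowth_iff]
  intro Q _ _ _ _
  exact_mod_cast Nat.card_pos

/-- To compare the factorial with a LEF growth function, it is enough to do so at the integers. -/
theorem growthLE_factorial_lefGrowth {G : Type*} [Group G] {S : Set G} {K : ℕ}
    (h : ∀ n, 2 ≤ n → (n ! : ℕ∞) ≤ lefGrowth S (K * n)) :
    GrowthLE (fun n : ℕ => (n ! : ℕ∞)) (lefGrowth S) := by
  -- If `⌈x⌉ ≥ 2` then `⌈x⌉ ≤ 2 * x`, which gives `2 * K`; the `+ 1` keeps the constant positive
  -- when `K = 0`.
  refine ⟨2 * K + 1, by positivity, fun x hx => ?_⟩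
  rcases le_or_gt 2 ⌈x⌉₊ with hn | hn
  · refine (h _ hn).trans (lefGrowth_mono S ?_)
    have h1 : (⌈x⌉₊ : ℝ) < x + 1 := Nat.ceil_lt_add_one hx.le
    have h2 : (2 : ℝ) ≤ ⌈x⌉₊ := by exact_mod_cast hn
    have h3 : (⌈x⌉₊ : ℝ) ≤ 2 * x := by linarith
    have h4 : (K : ℝ) * ⌈x⌉₊ ≤ (2 * K + 1) * x := by
      nlinarith [mul_le_mul_of_nonneg_left h3 (Nat.cast_nonneg (α := ℝ) K)]
    exact_mod_cast h4.trans (Nat.le_ceil _)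
  · have hx1 : (⌈x⌉₊) ! = 1 := Nat.factorial_eq_one.2 (by omega)
    simpa [hx1] using one_le_lefGrowth S _

end Growth

/-! ### Transpositions and their word length. -/

section SwapFamily

variable {G Ω : Type*} [Group G] [MulAction G Ω] [DecidableEq Ω]

/-- A family of elements of a group `G` acting on `Ω` which act as the transpositions of `Ω` and
are permuted by conjugation in the same way as these. -/
structure IsSwapFamily (t : Ω → Ω → G) : Prop where
  self : ∀ x, t x x = 1
  mul_self : ∀ x y, t x y * t x y = 1
  smul : ∀ x y z, t x y • z = Equiv.swap x y z
  conj : ∀ g x y, g * t x y * g⁻¹ = t (g • x) (g • y)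

variable {t : Ω → Ω → G}

theorem IsSwapFamily.conj_swap (ht : IsSwapFamily t) (a b x y : Ω) :
    t a b * t x y * t a b = t (Equiv.swap a b x) (Equiv.swap a b y) := by
  rw [← ht.smul, ← ht.smul, ← ht.conj, inv_eq_of_mul_eq_one_right (ht.mul_self a b)]

theorem IsSwapFamily.swap_eq (ht : IsSwapFamily t) {a b x y : Ω} (h : t a b = t x y) :
    Equiv.swap a b = Equiv.swap x y := by
  ext z
  rw [← ht.smul, ← ht.smul, h]

/-- The recursion expressing a transposition `(x z)` through `(x y)` and `(y z)`. -/
theorem IsSwapFamily.trichotomy (ht : IsSwapFamily t) (x y z : Ω) :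
    t x z = 1 ∨ t x z = t x y ∨ t x z = t x y * t y z * t x y := by
  by_cases hxz : z = x
  · left; rw [hxz, ht.self]
  by_cases hyz : z = y
  · right; left; rw [hyz]
  · right; right
    rw [ht.conj_swap, Equiv.swap_apply_right, Equiv.swap_apply_of_ne_of_ne hxz hyz]

theorem IsSwapFamily.mem_subgroup (ht : IsSwapFamily t) {H : Subgroup G} {x y z : Ω}
    (hxy : t x y ∈ H) (hyz : t y z ∈ H) : t x z ∈ H := by
  rcases ht.trichotomy x y z with h | h | h <;> rw [h]
  exacts [one_mem H, hxy, mul_mem (mul_mem hxy hyz) hxy]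

/-- Transpositions moving the base point by a word of length `n` have length linear in `n`. -/
theorem IsSwapFamily.mem_wordBall_base (ht : IsSwapFamily t) {S : Set G} {c : ℕ} {x : Ω}
    (hc : ∀ s, (s ∈ S ∨ s⁻¹ ∈ S) → t x (s • x) ∈ wordBall S c) :
    ∀ n, ∀ g ∈ wordBall S n, t x (g • x) ∈ wordBall S ((2 * c + 2) * n) := by
  refine wordBall_induction ?_ ?_ ?_
  · rw [one_smul, ht.self]
    exact one_mem_wordBall _ _
  · intro n g hg
    exact wordBall_mono S (Nat.mul_le_mul_left _ (Nat.le_succ n)) hg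
  · intro n s g hs hg
    rcases ht.trichotomy x (s • x) ((s * g) • x) with h | h | h <;> rw [h]
    · exact one_mem_wordBall _ _
    · refine wordBall_mono S ?_ (hc s hs)
      nlinarith
    -- The middle factor is the `s`-conjugate of `t x (g • x)`, so each letter costs `2 * c + 2`.
    · rw [mul_smul, ← ht.conj]
      refine wordBall_mono S ?_ (mul_mem_wordBall (mul_mem_wordBall (hc s hs)
        (conj_mem_wordBall (mem_wordBall_one hs) hg)) (hc s hs))
      apply le_of_eq
      ring

theorem IsSwapFamily.exists_mem_wordBall (ht : IsSwapFamily t) {S : Set G} (hfin : S.Finite)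
    (hS : Subgroup.closure S = ⊤) (x : Ω) :
    ∃ K : ℕ, ∀ n, ∀ g ∈ wordBall S n, ∀ h ∈ wordBall S n,
      t (g • x) (h • x) ∈ wordBall S (K * n) := by
  have hA : ((fun s => t x (s • x)) '' (S ∪ {s | s⁻¹ ∈ S})).Finite :=
    (hfin.union (hfin.preimage inv_injective.injOn)).image _
  obtain ⟨c, hc⟩ := exists_subset_wordBall hS hA
  -- Conjugating `t x (g⁻¹ * h • x)` by `g` gives the element sought, with length at most `(2 * c +
  -- 2) * 2n + 2n`.
  refine ⟨4 * c + 6, fun n g hg h hh => ?_⟩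
  have key := ht.mem_wordBall_base (S := S) (c := c) (x := x)
    (fun s hs => hc ⟨s, hs, rfl⟩) _ _ (mul_mem_wordBall (inv_mem_wordBall hg) hh)
  have := conj_mem_wordBall hg key
  rw [ht.conj, ← mul_smul, mul_inv_cancel_left] at this
  refine wordBall_mono S (le_of_eq ?_) this
  ring

end SwapFamily

/-- A permutation of a set with at least three elements is determined by its conjugation action on
transpositions. -/
theorem Equiv.Perm.eq_of_swap_eq {α : Type*} [Fintype α] [DecidableEq α]
    (hα : 3 ≤ Fintype.card α) {σ τ : Equiv.Perm α}
    (h : ∀ a b, Equiv.swap (σ a) (σ b) = Equiv.swap (τ a) (τ b)) : σ = τ := by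
  ext a
  by_contra hne
  -- Otherwise `swap (τ a) (τ b)` fixes `σ a`, whereas `swap (σ a) (σ b)` moves it. Two such `b`
  -- contradict injectivity of `τ`.
  have key : ∀ b, b ≠ a → τ b = σ a := by
    intro b hb
    by_contra hb'
    have h1 := congrArg (fun f : Equiv.Perm α => f (σ a)) (h a b)
    simp only [Equiv.swap_apply_left] at h1
    rw [Equiv.swap_apply_of_ne_of_ne hne (Ne.symm hb')] at h1
    exact hb (σ.injective h1)
  have hcard : 1 < (Finset.univ.erase a).card := by
    rw [Finset.card_erase_of_mem (Finset.mem_univ a), Finset.card_univ]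
    omega
  obtain ⟨b, hb, c, hc, hbc⟩ := Finset.one_lt_card.1 hcard
  exact hbc (τ.injective ((key b (Finset.ne_of_mem_erase hb)).trans
    (key c (Finset.ne_of_mem_erase hc)).symm))

/-! ### The factorial lower bound. -/

section LowerBound

variable {G Ω : Type*} [Group G] [MulAction G Ω] [DecidableEq Ω] {t : Ω → Ω → G}

/-- A finite group into which a ball containing all transpositions of a finite set `F` embeds
locally has at least as many elements as the symmetric group of `F`. -/
theorem IsSwapFamily.factorial_le_card (ht : IsSwapFamily t) {S : Set G} {R : ℕ} {F : Finset Ω}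
    (hF : 3 ≤ F.card) (hR : ∀ x ∈ F, ∀ y ∈ F, t x y ∈ wordBall S R)
    {Q : Type*} [Group Q] [Finite Q] {π : G → Q} (hπ : IsLocalEmbedding (wordBall S (3 * R)) π) :
    (F.card) ! ≤ Nat.card Q := by
  obtain ⟨hinj, hmul⟩ := hπ
  have hball : ∀ x y : F, t x y ∈ wordBall S (3 * R) := fun x y =>
    wordBall_mono S (by omega) (hR x x.2 y y.2)
  have hone : π 1 = 1 := by
    have h1 := one_mem_wordBall S (3 * R)
    have := hmul 1 h1 1 h1 (by rwa [mul_one])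
    rw [mul_one] at this
    exact left_eq_mul.1 this
  have hinv : ∀ x y : F, (π (t x y))⁻¹ = π (t x y) := by
    intro x y
    refine inv_eq_of_mul_eq_one_right ?_
    rw [← hmul _ (hball x y) _ (hball x y), ht.mul_self, hone]
    rw [ht.mul_self]
    exact one_mem_wordBall _ _
  have hconj : ∀ a b x y : F, π (t a b) * π (t x y) * (π (t a b))⁻¹ =
      π (t (Equiv.swap a b x : F) (Equiv.swap a b y : F)) := by
    intro a b x y
    have h2 : t a b * t x y ∈ wordBall S (3 * R) :=
      wordBall_mono S (by omega) (mul_mem_wordBall (hR a a.2 b b.2) (hR x x.2 y y.2))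
    have h3 : t a b * t x y * t a b ∈ wordBall S (3 * R) :=
      wordBall_mono S (by omega) (mul_mem_wordBall (mul_mem_wordBall (hR a a.2 b b.2)
        (hR x x.2 y y.2)) (hR a a.2 b b.2))
    rw [hinv, ← hmul _ (hball a b) _ (hball x y) h2, ← hmul _ h2 _ (hball a b) h3,
      ht.conj_swap, Subtype.val_injective.map_swap, Subtype.val_injective.map_swap]
  -- No homomorphism from `Sym(F)` is needed: an arbitrary choice of `q` for each `σ` is already
  -- injective.
  have hex : ∀ σ : Equiv.Perm F, ∃ q : Q, ∀ x y : F,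
      q * π (t x y) * q⁻¹ = π (t (σ x : F) (σ y : F)) := by
    intro σ
    induction σ using Equiv.Perm.swap_induction_on with
    | one => exact ⟨1, fun x y => by simp⟩
    | swap_mul f a b _ ih =>
      obtain ⟨q, hq⟩ := ih
      refine ⟨π (t a b) * q, fun x y => ?_⟩
      rw [Equiv.Perm.mul_apply, Equiv.Perm.mul_apply, ← hconj, ← hq]
      group
  choose q hq using hex
  have hqinj : Function.Injective q := by
    intro σ τ hστ
    refine Equiv.Perm.eq_of_swap_eq (by simpa using hF) fun a b => ?_
    have h1 : π (t (σ a : F) (σ b : F)) = π (t (τ a : F) (τ b : F)) := by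
      rw [← hq, ← hq, hστ]
    have h2 := ht.swap_eq (hinj (hball _ _) (hball _ _) h1)
    ext z
    rw [Subtype.val_injective.map_swap, Subtype.val_injective.map_swap, h2]
  have hcard := Nat.card_le_card_of_injective q hqinj
  rwa [Nat.card_eq_fintype_card, Fintype.card_perm, Fintype.card_coe] at hcard

theorem IsSwapFamily.growthLE_factorial [MulAction.IsPretransitive G Ω] [Infinite Ω]
    (ht : IsSwapFamily t) {S : Set G} (hfin : S.Finite) (hS : Subgroup.closure S = ⊤) :
    GrowthLE (fun n : ℕ => (n ! : ℕ∞)) (lefGrowth S) := by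
  obtain ⟨x⟩ := (inferInstance : Nonempty Ω)
  obtain ⟨K, hK⟩ := ht.exists_mem_wordBall hfin hS x
  refine growthLE_factorial_lefGrowth (K := 3 * K) fun n hn => ?_
  rw [le_lefGrowth_iff]
  intro Q _ _ π hπ
  obtain ⟨F, hF, hFx⟩ := exists_finset_subset_wordBall_orbit hS x n
  have hR : ∀ y ∈ F, ∀ z ∈ F, t y z ∈ wordBall S (K * n) := by
    intro y hy z hz
    obtain ⟨g, hg, rfl⟩ := hFx y hy
    obtain ⟨h, hh, rfl⟩ := hFx z hz
    exact hK n g hg h hh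
  rw [mul_assoc] at hπ
  have hle := ht.factorial_le_card (by omega) hR hπ
  rw [hF] at hle
  exact_mod_cast (Nat.factorial_le (Nat.le_succ n)).trans hle

end LowerBound

/-! ### The symmetric enrichment: action, transpositions, generation. -/

namespace SymmetricEnrichment

variable {Γ Ω : Type*} [Group Γ] [MulAction Γ Ω]

/-- The homomorphism to `Sym(Ω)` which is the inclusion on `FSym(Ω)` and the action on `Γ`. -/
def toPerm (Γ Ω : Type*) [Group Γ] [MulAction Γ Ω] :
    SymmetricEnrichment Γ Ω →* Equiv.Perm Ω :=
  SemidirectProduct.lift (FSym Ω).subtype (MulAction.toPermHom Γ Ω) fun g => by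
    ext σ : 1
    simp [enrichmentAction]

/-- The action of the symmetric enrichment on `Ω`. -/
instance instMulAction : MulAction (SymmetricEnrichment Γ Ω) Ω :=
  MulAction.compHom Ω (toPerm Γ Ω)

theorem smul_def (g : SymmetricEnrichment Γ Ω) (x : Ω) : g • x = toPerm Γ Ω g x := rfl

@[simp]
theorem inr_smul (g : Γ) (x : Ω) :
    (SemidirectProduct.inr g : SymmetricEnrichment Γ Ω) • x = g • x := by
  simp [smul_def, toPerm]

@[simp]
theorem inl_smul (σ : FSym Ω) (x : Ω) :
    (SemidirectProduct.inl σ : SymmetricEnrichment Γ Ω) • x = (σ : Equiv.Perm Ω) x := by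
  simp [smul_def, toPerm]

instance instIsPretransitive [MulAction.IsPretransitive Γ Ω] :
    MulAction.IsPretransitive (SymmetricEnrichment Γ Ω) Ω where
  exists_smul_eq x y := by
    obtain ⟨g, hg⟩ := MulAction.exists_smul_eq Γ x y
    exact ⟨SemidirectProduct.inr g, by rw [inr_smul, hg]⟩

theorem conj_inl (g : SymmetricEnrichment Γ Ω) (σ : FSym Ω) :
    g * SemidirectProduct.inl σ * g⁻¹ =
      SemidirectProduct.inl (MulAut.conjNormal (toPerm Γ Ω g) σ) := by
  refine SemidirectProduct.ext (Subtype.ext ?_) ?_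
  · have h : toPerm Γ Ω g = g.left * MulAction.toPermHom Γ Ω g.right := rfl
    have hinv : MulAction.toPerm (β := Ω) g.right⁻¹ = (MulAction.toPerm g.right)⁻¹ :=
      map_inv (MulAction.toPermHom Γ Ω) g.right
    rw [SemidirectProduct.mul_left, SemidirectProduct.mul_left, SemidirectProduct.inv_left,
      SemidirectProduct.mul_right, SemidirectProduct.right_inl, SemidirectProduct.left_inl,
      SemidirectProduct.left_inl, MulAut.conjNormal_apply, h]
    simp [enrichmentAction, MulAut.conjNormal_apply, mul_assoc, hinv]
  · simp

variable [DecidableEq Ω]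

theorem swap_mem_FSym (x y : Ω) : Equiv.swap x y ∈ FSym Ω := by
  refine (Set.toFinite {x, y}).subset ?_
  intro z hz
  by_contra h
  simp only [Set.mem_insert_iff, Set.mem_singleton_iff, not_or] at h
  exact hz (Equiv.swap_apply_of_ne_of_ne h.1 h.2)

/-- The transpositions of `Ω`, as elements of the symmetric enrichment. -/
def transposition (Γ : Type*) {Ω : Type*} [Group Γ] [MulAction Γ Ω] [DecidableEq Ω] (x y : Ω) :
    SymmetricEnrichment Γ Ω :=
  SemidirectProduct.inl ⟨Equiv.swap x y, swap_mem_FSym x y⟩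

theorem isSwapFamily_transposition : IsSwapFamily (transposition Γ (Ω := Ω)) where
  self x := by
    rw [transposition, ← map_one SemidirectProduct.inl]
    congr 1
    exact Subtype.ext (Equiv.swap_self x)
  mul_self x y := by
    rw [transposition, ← map_mul, ← map_one SemidirectProduct.inl]
    congr 1
    exact Subtype.ext (Equiv.swap_mul_self x y)
  smul x y z := by rw [transposition, inl_smul]
  conj g x y := by
    rw [transposition, conj_inl, transposition]
    congr 1
    refine Subtype.ext ?_
    rw [MulAut.conjNormal_apply, smul_def, smul_def]
    exact (Equiv.swap_apply_apply _ _ _).symm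

/-- Transpositions generate `FSym Ω`. -/
theorem eq_top_of_le {H : Subgroup (SymmetricEnrichment Γ Ω)}
    (hΓ : ∀ g : Γ, SemidirectProduct.inr g ∈ H) (ht : ∀ x y, transposition Γ x y ∈ H) :
    H = ⊤ := by
  have hle : Subgroup.closure {σ : Equiv.Perm Ω | σ.IsSwap} ≤
      (H.comap SemidirectProduct.inl).map (FSym Ω).subtype := by
    rw [Subgroup.closure_le]
    rintro _ ⟨x, y, _, rfl⟩
    exact ⟨⟨_, swap_mem_FSym x y⟩, ht x y, rfl⟩
  rw [eq_top_iff]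
  intro g _
  rw [← SemidirectProduct.inl_left_mul_inr_right g]
  refine mul_mem ?_ (hΓ _)
  obtain ⟨σ, hσ, hσg⟩ := hle (mem_closure_isSwap'.2 g.left.2)
  rwa [← Subtype.ext (a1 := σ) hσg]

/-- Besides generators `S` of `Γ`, the transpositions of `x` and `s • x` for `s ∈ S` suffice:
conjugating by `Γ` and composing along words yields all of them. -/
theorem fg [Group.FG Γ] [MulAction.IsPretransitive Γ Ω] [Nonempty Ω] :
    Group.FG (SymmetricEnrichment Γ Ω) := by
  obtain ⟨x⟩ := (inferInstance : Nonempty Ω)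
  obtain ⟨S, hS, hfin⟩ := Group.fg_iff.1 (inferInstance : Group.FG Γ)
  have hT := isSwapFamily_transposition (Γ := Γ) (Ω := Ω)
  refine Group.fg_iff.2 ⟨SemidirectProduct.inr '' S ∪ (fun s : Γ => transposition Γ x (s • x)) '' S,
    ?_, (hfin.image _).union (hfin.image _)⟩
  set H := Subgroup.closure (SemidirectProduct.inr '' S ∪
    (fun s : Γ => transposition Γ x (s • x)) '' S)
  have hΓ : ∀ g : Γ, SemidirectProduct.inr g ∈ H := by
    have : Subgroup.closure S ≤ H.comap SemidirectProduct.inr := by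
      rw [Subgroup.closure_le]
      intro s hs
      exact Subgroup.subset_closure (Or.inl ⟨s, hs, rfl⟩)
    intro g
    exact this (hS ▸ Subgroup.mem_top g)
  have hconj : ∀ (g : Γ) y z, transposition Γ y z ∈ H → transposition Γ (g • y) (g • z) ∈ H := by
    intro g y z h
    rw [← inr_smul g y, ← inr_smul g z, ← hT.conj]
    exact mul_mem (mul_mem (hΓ g) h) (inv_mem (hΓ g))
  have hsymm : ∀ y z, transposition Γ y z ∈ H → transposition Γ z y ∈ H := by
    intro y z h
    have : transposition Γ z y = transposition Γ y z := by
      simp only [transposition, Equiv.swap_comm z y]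
    rwa [this]
  have hbase : ∀ g : Γ, transposition Γ x (g • x) ∈ H := by
    intro g
    induction (hS ▸ Subgroup.mem_top g : g ∈ Subgroup.closure S) using
      Subgroup.closure_induction with
    | mem s hs => exact Subgroup.subset_closure (Or.inr ⟨s, hs, rfl⟩)
    | one => rw [one_smul, hT.self]; exact one_mem H
    | mul g h _ _ hg hh =>
      rw [mul_smul]
      exact hT.mem_subgroup hg (hconj g _ _ hh)
    | inv g _ hg => simpa using hsymm _ _ (hconj g⁻¹ _ _ hg)
  refine eq_top_of_le hΓ fun y z => ?_
  obtain ⟨g, rfl⟩ := MulAction.exists_smul_eq Γ x y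
  obtain ⟨h, rfl⟩ := MulAction.exists_smul_eq Γ x z
  exact hT.mem_subgroup (hsymm _ _ (hbase g)) (hbase h)

end SymmetricEnrichment

theorem corollary3p4 (Γ Ω : Type*) [Group Γ] [Group.FG Γ] [MulAction Γ Ω]
    [MulAction.IsPretransitive Γ Ω] [Infinite Ω] :
    Group.FG (SymmetricEnrichment Γ Ω) ∧
    (∀ T : Set (SymmetricEnrichment Γ Ω), T.Finite → Subgroup.closure T = ⊤ →
      GrowthLE (fun n : ℕ => (n ! : ℕ∞)) (lefGrowth T)) ∧
    ¬ IsELEF (SymmetricEnrichment Γ Ω) := by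
  classical
  have hT := SymmetricEnrichment.isSwapFamily_transposition (Γ := Γ) (Ω := Ω)
  refine ⟨SymmetricEnrichment.fg, fun T hfin hT' => hT.growthLE_factorial hfin hT', ?_⟩
  -- `hle` bounds LEF growth by word growth, which would make `n!` at most exponential.
  rintro ⟨S, hfin, hS, -, hle⟩
  obtain ⟨M, hM, hgrowth⟩ := exists_wordGrowth_le_pow hfin
  exact not_growthLE_factorial hM hgrowth ((hT.growthLE_factorial hfin hS).trans hle)
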